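/- Let $d\ge 1$ and $m\ge 1$ be integers, $\theta\in(0,\pi/2)$, $c>0$, and put $C(\theta)=\dfrac{16(1+\sin\theta)^2m^2}{3\sin^2\theta}$. Let $\varphi:[0,\infty)\to[0,\infty)$ be continuous with $\varphi(s)=0$ for $s>1$ and $\varphi(s)>0$ for $0\le s<1/2$. Then there is a constant $C>0$, depending only on $d,m,\theta,c,\varphi$, such that the following holds. Let $\Omega\subset\mathbb R^d$ be compact and satisfy an interior cone condition with radius $r>0$ and angle $\theta$: for every $\mathbf x\in\Omega$ there is a unit vector $\boldsymbol\xi$ with $\mathbf x+t\mathbf y\in\Omega$ for all $0\le t\le r$ and all unit vectors $\mathbf y$ with $\mathbf y\cdot\boldsymbol\xi\ge\cos\theta$. Let $\Omega_h\subset\mathbb R^d$ be a finite set of points, $\mathbf x_i\in\Omega_h\cap\Omega$, $\varepsilon>0$, and let $$X=M_i=\Big\{\mathbf x_{ij}=\tfrac12(\mathbf x_i+\mathbf x_j)\ :\ \mathbf x_j\in\Omega_h,\ \mathbf x_j\neq\mathbf x_i,\ \|\mathbf x_j-\mathbf x_i\|<\varepsilon\Big\}$$ be the set of midpoints of the edges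 from $\mathbf x_i$ to its $\varepsilon$-neighbours. Assume that $X$ is nonempty and quasi-uniform, $q_X\le h_{X,\Omega}\le c\,q_X$, where $h_{X,\Omega}=\sup_{\mathbf x\in\Omega}\min_{\mathbf y\in X}\|\mathbf x-\mathbf y\|$ is the fill distance and $q_X=\frac12\min_{\mathbf x\ne\mathbf y\in X}\|\mathbf x-\mathbf y\|$ is the separation distance, and that $h_{X,\Omega}\le r/C(\theta)$. Let $\delta=2C(\theta)h_{X,\Omega}$, $\Phi(t)=\varphi(t/\delta)$ and $\Omega^*=\overline{\mathcal B(\mathbf x_i,\delta)}$. Let $\mathbf u$ be a vector field on $\mathbb R^d$ whose restriction to $\Omega^*$ is of class $C^{m+1}$, let $u_{i\to}(\mathbf x)=\mathbf u(\mathbf x)\cdot 2(\mathbf x-\mathbf x_i)$ be its radial component, and let $P_m^i$ be the space of polynomials of degree at most $m$ on $\mathbb R^d$ that vanish at $\mathbf x_i$. Then the weighted least-squares problem $$p^*=\operatorname*{arg\,min}_{p\in P^i_m}\ \sum_{\mathbf x_{ij}\in M_i}\big(u_{i\to}(\mathbf x_{ij})-p(\mathbf x_{ij})\big)^2\,\Phi(\|\mathbf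 x_i-\mathbf x_{ij}\|)$$ has exactly one solution $p^*$; the GMLS gradient and Laplacian of $u_{i\to}$ at $\mathbf x_i$ are $\widetilde\nabla u_{i\to}(\mathbf x_i)=\nabla p^*(\mathbf x_i)$ and $\widetilde\Delta u_{i\to}(\mathbf x_i)=\Delta p^*(\mathbf x_i)$ (the coefficients of $p^*$ being held fixed). The GMLS approximations $\widetilde{\mathbf u}(\mathbf x_i)=\frac12\widetilde\nabla u_{i\to}(\mathbf x_i)$ and $\widetilde{\nabla\cdot}\,\mathbf u(\mathbf x_i)=\frac14\widetilde\Delta u_{i\to}(\mathbf x_i)$ satisfy $$\|\mathbf u(\mathbf x_i)-\widetilde{\mathbf u}(\mathbf x_i)\|\le C\,h_{X,\Omega}^{m}\,\|\mathbf u\|_{C^{m+1}(\Omega^*)},\qquad |\nabla\cdot\mathbf u(\mathbf x_i)-\widetilde{\nabla\cdot}\,\mathbf u(\mathbf x_i)|\le C\,h_{X,\Omega}^{m-1}\,\|\mathbf u\|_{C^{m+1}(\Omega^*)},$$ where $\|\mathbf u\|_{C^{m+1}(\Omega^*)}=\max_{0\le k\le m+1}\sup_{\mathbf x\in\Omega^*}\|D^k\mathbf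 u(\mathbf x)\|$ with the operator norms of the $k$-linear maps $D^k\mathbf u(\mathbf x)$. -/

import Mathlib

noncomputable section

namespace StaggeredGMLS

/-- The Euclidean space `ℝ^d`. -/
abbrev Pt (d : ℕ) : Type := EuclideanSpace ℝ (Fin d)

/-! ### Regions, point sets, weights -/

/-- Interior cone condition with radius `r` and angle `θ`: every `x ∈ Ω` is the apex of a cone
`{x + t y : ‖y‖ = 1, ⟪y, ξ⟫ ≥ cos θ, 0 ≤ t ≤ r}` contained in `Ω`, for some unit vector `ξ`. -/
def InteriorCone {d : ℕ} (Ω : Set (Pt d)) (r θ : ℝ) : Prop :=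
  ∀ x ∈ Ω, ∃ ξ : Pt d, ‖ξ‖ = 1 ∧
    ∀ y : Pt d, ‖y‖ = 1 → Real.cos θ ≤ inner ℝ y ξ →
      ∀ t : ℝ, 0 ≤ t → t ≤ r → x + t • y ∈ Ω

/-- Fill distance `h_{X,Ω} = sup_{x ∈ Ω} min_{y ∈ X} ‖x - y‖` (used for nonempty `X`). -/
def fillDistance {d : ℕ} (X : Finset (Pt d)) (Ω : Set (Pt d)) : ℝ :=
  ⨆ x : Ω, Metric.infDist (x : Pt d) (X : Set (Pt d))

/-- Separation distance `q_X = (1/2) min_{x ≠ y ∈ X} ‖x - y‖`. -/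
def separationDistance {d : ℕ} (X : Finset (Pt d)) : ℝ :=
  (1 / 2) * sInf {s : ℝ | ∃ x ∈ X, ∃ y ∈ X, x ≠ y ∧ s = ‖x - y‖}

/-- `X` is quasi-uniform in `Ω` with constant `c`: `q_X ≤ h_{X,Ω} ≤ c q_X`. -/
def QuasiUniform {d : ℕ} (X : Finset (Pt d)) (Ω : Set (Pt d)) (c : ℝ) : Prop :=
  X.Nonempty ∧ separationDistance X ≤ fillDistance X Ω ∧
    fillDistance X Ω ≤ c * separationDistance X

/-- The constant `C(θ) = 16 (1 + sin θ)² m² / (3 sin² θ)`. -/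
def coneConst (m : ℕ) (θ : ℝ) : ℝ :=
  16 * (1 + Real.sin θ) ^ 2 * (m : ℝ) ^ 2 / (3 * Real.sin θ ^ 2)

/-- The radius `δ = 2 C(θ) h_{X,Ω}` of the support of the weight. -/
def supportRadius {d : ℕ} (m : ℕ) (θ : ℝ) (X : Finset (Pt d)) (Ω : Set (Pt d)) : ℝ :=
  2 * coneConst m θ * fillDistance X Ω

/-- Profile `φ` of a radial weight: continuous and nonnegative on `[0,∞)`, zero beyond `1`,
positive on `[0, 1/2)`. -/
structure IsWeightProfile (φ : ℝ → ℝ) : Prop where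
  continuousOn : ContinuousOn φ (Set.Ici 0)
  nonneg : ∀ s, 0 ≤ s → 0 ≤ φ s
  support : ∀ s, 1 < s → φ s = 0
  pos : ∀ s, 0 ≤ s → s < 1 / 2 → 0 < φ s

/-- The weight `Φ(t) = φ(t / δ)`: it vanishes for `t > δ` and is positive for `0 ≤ t < δ / 2`. -/
def scaledWeight (φ : ℝ → ℝ) (δ : ℝ) : ℝ → ℝ := fun t => φ (t / δ)

/-! ### The local grid -/

open Classical in
/-- The `ε`-neighbourhood of `x` in the discretization `nodes`. -/
def neighborhood {d : ℕ} (nodes : Finset (Pt d)) (ε : ℝ) (x : Pt d) : Finset (Pt d) :=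
  nodes.filter (fun y => ‖y - x‖ < ε)

open Classical in
/-- The midpoints `(x + y) / 2` of the edges from `x` to the other points `y` of its
`ε`-neighbourhood. -/
def midpoints {d : ℕ} (nodes : Finset (Pt d)) (ε : ℝ) (x : Pt d) : Finset (Pt d) :=
  ((neighborhood nodes ε x).erase x).image (fun y => (1 / 2 : ℝ) • (x + y))

/-! ### GMLS approximation with the polynomials that vanish at `x` -/

/-- `P_m^x`: polynomials of degree at most `m` that vanish at `x`. -/
def polySpace {d : ℕ} (m : ℕ) (x : Pt d) : Set (MvPolynomial (Fin d) ℝ) :=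
  {p | p.totalDegree ≤ m ∧ MvPolynomial.eval x.ofLp p = 0}

/-- The weighted least-squares functional `∑_{y ∈ X} (f(y) - p(y))² Φ(‖x - y‖)`. -/
def lsFunctional {d : ℕ} (Φ : ℝ → ℝ) (X : Finset (Pt d)) (x : Pt d) (f : Pt d → ℝ)
    (p : MvPolynomial (Fin d) ℝ) : ℝ :=
  ∑ y ∈ X, (f y - MvPolynomial.eval y.ofLp p) ^ 2 * Φ ‖x - y‖

/-- `p` is a minimizer over `P_m^x` of the weighted least-squares functional. -/
def IsGMLSFit {d : ℕ} (m : ℕ) (Φ : ℝ → ℝ) (X : Finset (Pt d)) (x : Pt d) (f : Pt d → ℝ)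
    (p : MvPolynomial (Fin d) ℝ) : Prop :=
  p ∈ polySpace m x ∧ ∀ q ∈ polySpace m x, lsFunctional Φ X x f p ≤ lsFunctional Φ X x f q

open Classical in
/-- The least-squares polynomial `p*` (a minimizer, if there is one, and `0` otherwise). -/
def gmlsFit {d : ℕ} (m : ℕ) (Φ : ℝ → ℝ) (X : Finset (Pt d)) (x : Pt d) (f : Pt d → ℝ) :
    MvPolynomial (Fin d) ℝ :=
  if h : ∃ p, IsGMLSFit m Φ X x f p then h.choose else 0

/-- GMLS gradient of `f` at `x`: with `p* = ∑ b_k p_k`, the vector `∑ b_k ∇p_k(x)`, that is, the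
gradient at `x` of the polynomial `p*` (whose coefficients are fixed numbers). -/
def gmlsGradient {d : ℕ} (m : ℕ) (Φ : ℝ → ℝ) (X : Finset (Pt d)) (x : Pt d) (f : Pt d → ℝ) :
    Pt d :=
  WithLp.toLp 2 fun k => MvPolynomial.eval x.ofLp (MvPolynomial.pderiv k (gmlsFit m Φ X x f))

/-- GMLS Laplacian of `f` at `x`: the number `∑ b_k Δp_k(x)`, the Laplacian of `p*` at `x`. -/
def gmlsLaplacian {d : ℕ} (m : ℕ) (Φ : ℝ → ℝ) (X : Finset (Pt d)) (x : Pt d) (f : Pt d → ℝ) :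
    ℝ :=
  ∑ k, MvPolynomial.eval x.ofLp
    (MvPolynomial.pderiv k (MvPolynomial.pderiv k (gmlsFit m Φ X x f)))

/-! ### Vector fields -/

/-- The radial component `y ↦ u(y) · 2 (y - x)` of the field `u` in the direction of `x`. -/
def radialComponent {d : ℕ} (u : Pt d → Pt d) (x : Pt d) : Pt d → ℝ :=
  fun y => inner ℝ (u y) ((2 : ℝ) • (y - x))

/-- GMLS approximation `(1/2) ∇̃ u_{x→}(x)` of `u(x)`. -/
def gmlsField {d : ℕ} (m : ℕ) (Φ : ℝ → ℝ) (X : Finset (Pt d)) (x : Pt d) (u : Pt d → Pt d) :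
    Pt d :=
  (1 / 2 : ℝ) • gmlsGradient m Φ X x (radialComponent u x)

/-- GMLS approximation `(1/4) Δ̃ u_{x→}(x)` of `∇·u(x)`. -/
def gmlsDivergence {d : ℕ} (m : ℕ) (Φ : ℝ → ℝ) (X : Finset (Pt d)) (x : Pt d)
    (u : Pt d → Pt d) : ℝ :=
  (1 / 4 : ℝ) * gmlsLaplacian m Φ X x (radialComponent u x)

/-- The divergence `∑_k ∂_k u_k(x)`. -/
def divergence {d : ℕ} (u : Pt d → Pt d) (x : Pt d) : ℝ :=
  ∑ k, (fderiv ℝ u x (EuclideanSpace.single k 1)).ofLp k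

/-- The norm of `C^n(S)`: the maximum over `j ≤ n` of the suprema over `S` of the norms of the
`j`-th derivatives. -/
def cNorm {d : ℕ} (n : ℕ) (S : Set (Pt d)) (u : Pt d → Pt d) : ℝ :=
  ⨆ j : Fin (n + 1), ⨆ x : S, ‖iteratedFDerivWithin ℝ (j : ℕ) u S (x : Pt d)‖

end StaggeredGMLS

end

/-! The radial component has a good competitor in `P_m^x`. With `T` the Taylor polynomial of `u` at
`x` of degree `m - 1`, put `q(y) = 2⟨T(y), y - x⟩`. Then `q` has degree at most `m` and vanishes at
`x`, `∇q(x) = 2u(x)`, and `Δq(x) = 4 ∇·u(x)` if `m ≥ 2`. The factor `y - x` raises the Taylor error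
`O(δ^m)` to `O(δ^(m+1))` on the ball (`exists_polySpace_radialComponent`).

It remains to compare `p*` with `q` (`exists_pderiv_sub_le`). Minimality bounds the weighted sum of
squares of `p* - q` over the nodes by four times the functional at `q`, and separation bounds the
number of nodes in the support of the weight. Hence `p* - q` is `O(δ^(m+1))` at each node within
`δ/4` of `x`, where the weight is bounded below. These nodes are `h`-dense in a ball of radius `κh`,
`κ ≥ 5m²`, inside the cone at `x`; by Markov's inequality they control a polynomial of degree `m` on
that ball up to a factor `2` (`abs_eval_le_two_mul_of_dense`). Passing to first and second
derivatives at `x` costs `h⁻¹` and `h⁻²`, which leaves `h^m` and `h^(m-1)`. The same norming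
property gives uniqueness of `p*`. -/

namespace StaggeredGMLS

/-! ### Univariate polynomial inequalities -/

open Polynomial in
/-- Markov's inequality at the left endpoint of an interval. -/
theorem abs_eval_derivative_mul_le {m : ℕ} {P : ℝ[X]} (hP : P.natDegree ≤ m) {a b M : ℝ}
    (hab : a < b) (hM : 0 < M) (h : ∀ t ∈ Set.Icc a b, |P.eval t| ≤ M) :
    |P.derivative.eval a| * (b - a) ≤ 2 * (m : ℝ) ^ 2 * M := by
  have key : ∀ σ : ℝ, |σ| = 1 →
      σ * (P.derivative.eval a) * (b - a) ≤ 2 * (m : ℝ) ^ 2 * M := by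
    intro σ hσ
    -- The substitution sends `1` to `a` and `-1` to `b`, so the extremal value is `T_m'(1) = m²`.
    -- The sign in `-σ` cancels the one produced by reversing the interval.
    set Q : ℝ[X] := C (-σ / M) * P.comp (C ((a + b) / 2) - C ((b - a) / 2) * X) with hQ
    have hdeg : Q.degree ≤ m := by
      refine degree_le_of_natDegree_le ?_
      refine (natDegree_C_mul_le _ _).trans ?_
      refine natDegree_comp_le.trans ?_
      have : (C ((a + b) / 2) - C ((b - a) / 2) * X : ℝ[X]).natDegree ≤ 1 := by
        compute_degree
      calc _ ≤ m * 1 := Nat.mul_le_mul hP this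
        _ = m := mul_one m
    have hb : ∀ x ∈ Set.Icc (-1 : ℝ) 1, |Q.eval x| ≤ 1 := by
      intro x hx
      have hx' : (a + b) / 2 - (b - a) / 2 * x ∈ Set.Icc a b :=
        ⟨by nlinarith [hx.1, hx.2], by nlinarith [hx.1, hx.2]⟩
      simp only [hQ, eval_mul, eval_C, eval_comp, eval_sub, eval_X, abs_mul, abs_div, abs_neg, hσ,
        abs_of_pos hM]
      rw [one_div_mul_eq_div, div_le_one hM]
      exact h _ hx'
    have := Chebyshev.eval_iterate_derivative_le_of_forall_abs_le_one (k := 1) le_rfl hdeg hb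
    simp only [Function.iterate_one, Chebyshev.T_derivative_eq_U, hQ] at this
    simp only [derivative_mul, derivative_C, derivative_comp, derivative_sub, derivative_X,
      eval_mul, eval_C, eval_comp, eval_sub, eval_X, zero_mul, zero_add, mul_one,
      zero_sub, eval_neg, Chebyshev.U_eval_one] at this
    rw [show (a + b) / 2 - (b - a) / 2 = a by ring] at this
    have h2 : -σ / M * (-((b - a) / 2) * eval a (derivative P)) * (2 * M)
        = σ * eval a (derivative P) * (b - a) := by field_simp
    rw [← h2]
    have h3 := mul_le_mul_of_nonneg_right this (by positivity : 0 ≤ 2 * M)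
    refine h3.trans (le_of_eq ?_)
    push_cast
    simp
    ring
  rcases abs_cases (P.derivative.eval a) with ⟨h1, -⟩ | ⟨h1, -⟩
  · rw [h1]; simpa using key 1 (by simp)
  · rw [h1]; simpa using key (-1) (by simp)

open Polynomial in
/-- A bound of a polynomial on `[-1, 1]` controls its coefficients. -/
theorem exists_abs_coeff_le (m : ℕ) : ∃ A : ℝ, 0 ≤ A ∧ ∀ (P : ℝ[X]) (M : ℝ), P.natDegree ≤ m →
    (∀ t ∈ Set.Icc (-1 : ℝ) 1, |P.eval t| ≤ M) → ∀ k, |P.coeff k| ≤ A * M := by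
  -- Lagrange interpolation at `m + 1` nodes in `[0, 1)` makes each coefficient a fixed linear
  -- combination of values of `P`.
  set v : ℕ → ℝ := fun i => i / (m + 1) with hv
  have hinj : Set.InjOn v (Finset.range (m + 1)) := by
    intro i _ j _ hij
    have : ((m : ℝ) + 1) ≠ 0 := by positivity
    simp only [hv] at hij
    field_simp at hij
    exact_mod_cast hij
  set B := fun i => Lagrange.basis (Finset.range (m + 1)) v i with hB
  refine ⟨∑ i ∈ Finset.range (m + 1), ∑ k ∈ Finset.range (m + 1), |(B i).coeff k|,
    by positivity, fun P M hP h k => ?_⟩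
  have hM : 0 ≤ M := (abs_nonneg _).trans (h 0 (by simp))
  rcases lt_or_ge m k with hk | hk
  · rw [coeff_eq_zero_of_natDegree_lt (hP.trans_lt hk), abs_zero]
    exact mul_nonneg (by positivity) hM
  have hd : P.degree < (Finset.range (m + 1)).card := by
    rw [Finset.card_range]
    exact (degree_le_of_natDegree_le hP).trans_lt (by exact_mod_cast Nat.lt_succ_self m)
  rw [Lagrange.eq_interpolate hinj hd, Lagrange.interpolate_apply, finsetSum_coeff,
    Finset.sum_mul]
  refine (Finset.abs_sum_le_sum_abs _ _).trans (Finset.sum_le_sum fun i hi => ?_)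
  rw [coeff_C_mul, abs_mul, mul_comm]
  refine mul_le_mul ?_ (h _ ?_) (abs_nonneg _) (by positivity)
  · exact Finset.single_le_sum (f := fun k => |(B i).coeff k|) (fun _ _ => abs_nonneg _)
      (Finset.mem_range.2 (Nat.lt_succ_of_le hk))
  · have h0 : (0 : ℝ) ≤ i / ((m : ℝ) + 1) := by positivity
    refine ⟨by simp only [hv]; linarith, ?_⟩
    simp only [hv]
    rw [div_le_one (by positivity)]
    have := Finset.mem_range.1 hi
    exact_mod_cast this.le

open Polynomial in
/-- A bound of a polynomial on `[-1, 1]` controls its growth. -/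
theorem exists_abs_eval_le (m : ℕ) (T : ℝ) (hT : 1 ≤ T) : ∃ A : ℝ, 0 ≤ A ∧
    ∀ (P : ℝ[X]) (M : ℝ), P.natDegree ≤ m →
    (∀ t ∈ Set.Icc (-1 : ℝ) 1, |P.eval t| ≤ M) → ∀ t, |t| ≤ T → |P.eval t| ≤ A * M := by
  obtain ⟨A, hA, h⟩ := exists_abs_coeff_le m
  refine ⟨(m + 1) * (A * T ^ m), by positivity, fun P M hP hb t ht => ?_⟩
  have hM : 0 ≤ M := (abs_nonneg _).trans (hb 0 (by simp))
  rw [eval_eq_sum_range' (Nat.lt_succ_of_le hP)]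
  refine (Finset.abs_sum_le_sum_abs _ _).trans ?_
  have : ∀ i ∈ Finset.range (m + 1), |P.coeff i * t ^ i| ≤ A * M * T ^ m := by
    intro i hi
    rw [abs_mul, abs_pow]
    refine mul_le_mul (h P M hP hb i) ?_ (by positivity) (by positivity)
    exact (pow_le_pow_left₀ (abs_nonneg _) ht i).trans
      (pow_le_pow_right₀ hT (Nat.lt_succ_iff.1 (Finset.mem_range.1 hi)))
  refine (Finset.sum_le_card_nsmul _ _ _ this).trans (le_of_eq ?_)
  simp
  ring

end StaggeredGMLS

/-! ### Multivariate polynomials along lines, and norming sets -/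

namespace StaggeredGMLS

/-- The restriction of `p` to the line `t ↦ x + t v`. -/
noncomputable def linePoly {d : ℕ} (p : MvPolynomial (Fin d) ℝ) (x v : Pt d) : Polynomial ℝ :=
  MvPolynomial.aeval (fun i => Polynomial.C (x i) + Polynomial.C (v i) * Polynomial.X) p

theorem eval_linePoly {d : ℕ} (p : MvPolynomial (Fin d) ℝ) (x v : Pt d) (t : ℝ) :
    (linePoly p x v).eval t = MvPolynomial.eval (x + t • v).ofLp p := by
  rw [linePoly, ← Polynomial.coe_evalRingHom, MvPolynomial.aeval_def,
    MvPolynomial.hom_eval₂]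
  have h1 : (Polynomial.evalRingHom t).comp (algebraMap ℝ (Polynomial ℝ)) = RingHom.id ℝ := by
    ext r; simp
  rw [h1, ← MvPolynomial.eval₂_id]
  congr 1
  ext i
  simp only [Polynomial.coe_evalRingHom, Polynomial.eval_add,
    Polynomial.eval_mul, Polynomial.eval_C, Polynomial.eval_X, PiLp.add_apply, PiLp.smul_apply,
    smul_eq_mul, mul_comm]

theorem natDegree_linePoly_le {d m : ℕ} {p : MvPolynomial (Fin d) ℝ} (hp : p.totalDegree ≤ m)
    (x v : Pt d) : (linePoly p x v).natDegree ≤ m := by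
  have := MvPolynomial.aeval_natDegree_le (n := 1) p hp
    (fun i => Polynomial.C (x i) + Polynomial.C (v i) * Polynomial.X)
    (fun i => by compute_degree)
  simpa [linePoly] using this

/-- The chain rule in a coordinate direction. It lets the partial derivatives at `x` be read off the
coefficients of a univariate restriction, so that univariate bounds suffice. -/
theorem derivative_linePoly {d : ℕ} (p : MvPolynomial (Fin d) ℝ) (x : Pt d) (r : ℝ) (k : Fin d) :
    (linePoly p x (r • EuclideanSpace.single k 1)).derivative
      = Polynomial.C r * linePoly (MvPolynomial.pderiv k p) x (r • EuclideanSpace.single k 1) := by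
  induction p using MvPolynomial.induction_on with
  | C a => simp [linePoly]
  | add p q hp hq => simp only [linePoly, map_add, mul_add] at *; rw [hp, hq]
  | mul_X p i hp =>
    simp only [linePoly, map_mul, Polynomial.derivative_mul, Derivation.leibniz, map_add,
      smul_eq_mul, MvPolynomial.aeval_X, MvPolynomial.pderiv_X] at *
    rw [hp]
    by_cases hik : i = k
    · subst hik
      simp
      ring
    · simp [hik]
      ring

theorem coeff_one_linePoly {d : ℕ} (p : MvPolynomial (Fin d) ℝ) (x : Pt d) (r : ℝ) (k : Fin d) :
    (linePoly p x (r • EuclideanSpace.single k 1)).coeff 1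
      = r * MvPolynomial.eval x.ofLp (MvPolynomial.pderiv k p) := by
  have h := congrArg (fun q => Polynomial.eval 0 q) (derivative_linePoly p x r k)
  simp only [Polynomial.eval_mul, Polynomial.eval_C, eval_linePoly, zero_smul, add_zero] at h
  rw [← h, ← Polynomial.coeff_zero_eq_eval_zero, Polynomial.coeff_derivative]
  simp

theorem coeff_two_linePoly {d : ℕ} (p : MvPolynomial (Fin d) ℝ) (x : Pt d) (r : ℝ) (k : Fin d) :
    (linePoly p x (r • EuclideanSpace.single k 1)).coeff 2
      = r ^ 2 / 2 * MvPolynomial.eval x.ofLp (MvPolynomial.pderiv k (MvPolynomial.pderiv k p)) := by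
  have h := congrArg (fun q => Polynomial.coeff q 1) (derivative_linePoly p x r k)
  simp only [Polynomial.coeff_C_mul, coeff_one_linePoly, Polynomial.coeff_derivative] at h
  norm_num at h
  linear_combination h / 2

theorem continuous_evalPt {d : ℕ} (p : MvPolynomial (Fin d) ℝ) :
    Continuous fun y : Pt d => MvPolynomial.eval y.ofLp p :=
  (MvPolynomial.continuous_eval p).comp (PiLp.continuous_ofLp 2 _)

/-- A sufficiently dense subset of a ball is a norming set for the polynomials of degree `≤ m`. -/
theorem abs_eval_le_two_mul_of_dense {d m : ℕ} (hm : 0 < m) {p : MvPolynomial (Fin d) ℝ}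
    (hp : p.totalDegree ≤ m) {z : Pt d} {ρ h B : ℝ} (hh : 0 < h) (hρ : 5 * (m : ℝ) ^ 2 * h ≤ ρ)
    {X : Set (Pt d)} (hX : ∀ y ∈ Metric.closedBall z ρ, ∃ x ∈ X, ‖x - y‖ ≤ h)
    (hB : ∀ x ∈ X, x ∈ Metric.closedBall z ρ → |MvPolynomial.eval x.ofLp p| ≤ B) :
    ∀ y ∈ Metric.closedBall z ρ, |MvPolynomial.eval y.ofLp p| ≤ 2 * B := by
  have hm1 : (1 : ℝ) ≤ m := by exact_mod_cast hm
  have hm2 : (1 : ℝ) ≤ (m : ℝ) ^ 2 := one_le_pow₀ hm1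
  have hρ0 : 0 < ρ := lt_of_lt_of_le (by positivity) hρ
  obtain ⟨x, hx, hmax⟩ := (isCompact_closedBall z ρ).exists_isMaxOn
    ⟨z, Metric.mem_closedBall_self hρ0.le⟩ (continuous_evalPt p).abs.continuousOn
  set N := |MvPolynomial.eval x.ofLp p| with hN
  have hmax' : ∀ y ∈ Metric.closedBall z ρ, |MvPolynomial.eval y.ofLp p| ≤ N := hmax
  suffices N ≤ 2 * B from fun y hy => (hmax' y hy).trans this
  have hxz : ‖x - z‖ ≤ ρ := by simpa [dist_eq_norm] using hx
  -- Moving the maximum point `x` towards `z` by the fraction `l` makes room for a ball of radius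
  -- `lρ = h`, which contains a point `xj` of `X`. By homothety the segment from `x` through `xj`,
  -- prolonged `1/l ≥ 5m²` times, stays in the big ball.
  set l := h / ρ with hl
  have hl0 : 0 < l := by positivity
  have hlρ : l * ρ = h := by rw [hl]; field_simp
  have hlT : 5 * (m : ℝ) ^ 2 * l ≤ 1 := by
    rw [hl, ← mul_div_assoc, div_le_one hρ0]; exact hρ
  have hl1 : l ≤ 1 := by nlinarith
  obtain ⟨xj, hxj, hd⟩ := hX (x + l • (z - x)) (by
    rw [mem_closedBall_iff_norm, show x + l • (z - x) - z = (1 - l) • (x - z) by module,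
      norm_smul, Real.norm_of_nonneg (by linarith)]
    nlinarith [norm_nonneg (x - z)])
  set w := xj - x with hw
  have hline : ∀ t ∈ Set.Icc 0 (1 / l), x + t • w ∈ Metric.closedBall z ρ := by
    intro t ht
    have ht1 : t * l ≤ 1 := by have := ht.2; rwa [le_div_iff₀ hl0] at this
    rw [mem_closedBall_iff_norm, show x + t • w - z
      = (1 - t * l) • (x - z) + t • (xj - (x + l • (z - x))) by rw [hw]; module]
    refine (norm_add_le _ _).trans ?_
    rw [norm_smul, norm_smul, Real.norm_of_nonneg (by linarith), Real.norm_of_nonneg ht.1]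
    calc _ ≤ (1 - t * l) * ρ + t * h :=
          add_le_add (mul_le_mul_of_nonneg_left hxz (by linarith))
            (mul_le_mul_of_nonneg_left hd ht.1)
      _ = ρ := by rw [← hlρ]; ring
  have hT5 : 5 * (m : ℝ) ^ 2 ≤ 1 / l := by rwa [le_div_iff₀ hl0]
  set q := linePoly p x w with hq
  have hqb : ∀ t ∈ Set.Icc 0 (1 / l), |q.eval t| ≤ N := fun t ht => by
    rw [hq, eval_linePoly]; exact hmax' _ (hline t ht)
  have hxjB : |MvPolynomial.eval xj.ofLp p| ≤ B := hB xj hxj (by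
    have := hline 1 ⟨zero_le_one, by nlinarith⟩
    rwa [one_smul, hw, add_sub_cancel] at this)
  rcases (abs_nonneg (MvPolynomial.eval x.ofLp p)).eq_or_lt with h0 | hNpos
  · rw [hN, ← h0]; linarith [abs_nonneg (MvPolynomial.eval xj.ofLp p)]
  -- Markov on `[t, 1/l]`, of length at least `5m² - 1 ≥ 4m²`, gives slope at most `N/2`. So `|p|`
  -- drops by at most half between `x` and `xj`.
  have hder : ∀ t ∈ Set.Icc (0 : ℝ) 1, ‖q.derivative.eval t‖ ≤ N / 2 := by
    intro t ht
    have h1 := abs_eval_derivative_mul_le (natDegree_linePoly_le hp x w) (a := t) (b := 1 / l)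
      (by nlinarith [ht.2]) hNpos (fun s hs => hqb s ⟨ht.1.trans hs.1, hs.2⟩)
    rw [Real.norm_eq_abs]
    have h2 : 4 * (m : ℝ) ^ 2 ≤ 1 / l - t := by linarith [ht.2]
    have h3 := mul_le_mul_of_nonneg_left h2 (abs_nonneg (q.derivative.eval t))
    have h4 : |q.derivative.eval t| * (4 * (m : ℝ) ^ 2) ≤ N / 2 * (4 * (m : ℝ) ^ 2) := by
      refine (h3.trans h1).trans (le_of_eq (by ring))
    exact le_of_mul_le_mul_right h4 (by positivity)
  have hmv := (convex_Icc (0 : ℝ) 1).norm_image_sub_le_of_norm_hasDerivWithin_le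
    (f := fun t => q.eval t) (f' := fun t => q.derivative.eval t)
    (fun t _ => (q.hasDerivAt t).hasDerivWithinAt) hder
    (Set.left_mem_Icc.2 zero_le_one) (Set.right_mem_Icc.2 zero_le_one)
  simp only [hq, eval_linePoly, one_smul, zero_smul, add_zero, hw, add_sub_cancel, sub_zero,
    norm_one, mul_one, Real.norm_eq_abs] at hmv
  have := abs_sub_abs_le_abs_sub (MvPolynomial.eval x.ofLp p) (MvPolynomial.eval xj.ofLp p)
  rw [abs_sub_comm] at hmv
  linarith

/-- A bound of a polynomial on a ball controls it on a larger concentric ball. -/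
theorem exists_abs_eval_le_of_closedBall (m : ℕ) (T : ℝ) (hT : 1 ≤ T) :
    ∃ A : ℝ, 0 ≤ A ∧ ∀ {d : ℕ} (p : MvPolynomial (Fin d) ℝ) (z : Pt d) (ρ M : ℝ),
      p.totalDegree ≤ m → 0 < ρ →
      (∀ y ∈ Metric.closedBall z ρ, |MvPolynomial.eval y.ofLp p| ≤ M) →
      ∀ y ∈ Metric.closedBall z (T * ρ), |MvPolynomial.eval y.ofLp p| ≤ A * M := by
  obtain ⟨A, hA, h⟩ := exists_abs_eval_le m T hT
  refine ⟨A, hA, fun {d} p z ρ M hp hρ hb y hy => ?_⟩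
  have hyz : ‖y - z‖ ≤ T * ρ := by simpa [dist_eq_norm] using hy
  -- On this line `|t| ≤ 1` stays in the small ball, and `t = T` is the point `y`.
  have := h (linePoly p z (T⁻¹ • (y - z))) M (natDegree_linePoly_le hp _ _) (fun t ht => by
    rw [eval_linePoly]
    refine hb _ ?_
    rw [mem_closedBall_iff_norm, add_sub_cancel_left, norm_smul, norm_smul, norm_inv,
      Real.norm_of_nonneg (zero_le_one.trans hT), Real.norm_eq_abs]
    have h1 : T⁻¹ * ‖y - z‖ ≤ ρ := by
      rw [inv_mul_le_iff₀ (by linarith)]; exact hyz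
    calc |t| * (T⁻¹ * ‖y - z‖) ≤ 1 * ρ :=
          mul_le_mul (abs_le.2 ht) h1 (by positivity) zero_le_one
      _ = ρ := one_mul ρ) T (abs_of_nonneg (by linarith)).le
  rw [eval_linePoly, smul_smul, mul_inv_cancel₀ (by positivity), one_smul] at this
  simpa using this

/-- A bound of a polynomial on a ball controls its first and second partial derivatives at any
point whose distance to the centre is comparable with the radius. -/
theorem exists_abs_pderiv_le (m : ℕ) (T : ℝ) (hT : 0 ≤ T) :
    ∃ A : ℝ, 0 ≤ A ∧ ∀ {d : ℕ} (p : MvPolynomial (Fin d) ℝ) (x z : Pt d) (ρ M : ℝ),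
      p.totalDegree ≤ m → 0 < ρ → ‖x - z‖ ≤ T * ρ →
      (∀ y ∈ Metric.closedBall z ρ, |MvPolynomial.eval y.ofLp p| ≤ M) → ∀ k,
      ρ * |MvPolynomial.eval x.ofLp (MvPolynomial.pderiv k p)| ≤ A * M ∧
      ρ ^ 2 * |MvPolynomial.eval x.ofLp (MvPolynomial.pderiv k (MvPolynomial.pderiv k p))|
        ≤ A * M := by
  obtain ⟨A, hA, h⟩ := exists_abs_eval_le_of_closedBall m (T + 1) (by linarith)
  obtain ⟨A', hA', h'⟩ := exists_abs_coeff_le m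
  -- The `2` comes from the second coefficient, which is half the second derivative. The segment `x
  -- ± ρ e_k` lies in the ball of radius `(T + 1)ρ`.
  refine ⟨2 * (A' * A), by positivity, fun {d} p x z ρ M hp hρ hxz hb k => ?_⟩
  have hc := h' (linePoly p x (ρ • EuclideanSpace.single k 1)) (A * M)
    (natDegree_linePoly_le hp _ _) (fun t ht => by
      rw [eval_linePoly]
      refine h p z ρ M hp hρ hb _ ?_
      rw [mem_closedBall_iff_norm, add_sub_right_comm]
      refine (norm_add_le _ _).trans ?_
      rw [norm_smul, norm_smul, Real.norm_of_nonneg hρ.le, Real.norm_eq_abs,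
        PiLp.norm_single, norm_one, mul_one]
      nlinarith [abs_le.2 ht])
  have h0 : 0 ≤ A' * (A * M) := (abs_nonneg _).trans (hc 0)
  have h1 := hc 1
  have h2 := hc 2
  rw [coeff_one_linePoly, abs_mul, abs_of_pos hρ] at h1
  rw [coeff_two_linePoly, abs_mul, abs_of_pos (by positivity)] at h2
  constructor <;> nlinarith

/-- The bound `0` on the ball propagates to every larger ball, hence to every point. -/
theorem eq_zero_of_eval_closedBall {d : ℕ} {p : MvPolynomial (Fin d) ℝ} {z : Pt d} {ρ : ℝ}
    (hρ : 0 < ρ) (h : ∀ y ∈ Metric.closedBall z ρ, MvPolynomial.eval y.ofLp p = 0) : p = 0 := by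
  refine MvPolynomial.funext fun y => ?_
  obtain ⟨A, -, hA⟩ := exists_abs_eval_le_of_closedBall p.totalDegree
    (1 + ‖WithLp.toLp 2 y - z‖ / ρ) (by have : 0 ≤ ‖WithLp.toLp 2 y - z‖ / ρ := by positivity
                                        linarith)
  have := hA p z ρ 0 le_rfl hρ (fun y hy => by rw [h y hy, abs_zero]) (WithLp.toLp 2 y) (by
    rw [mem_closedBall_iff_norm, add_mul, div_mul_cancel₀ _ hρ.ne']
    linarith)
  simpa using this

end StaggeredGMLS

/-! ### Taylor expansion on a closed ball -/

namespace StaggeredGMLS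

section Taylor

variable {E F : Type*} [NormedAddCommGroup E] [NormedSpace ℝ E] [NormedAddCommGroup F]
  [NormedSpace ℝ F]

theorem uniqueDiffOn_closedBall {x : E} {δ : ℝ} (hδ : 0 < δ) :
    UniqueDiffOn ℝ (Metric.closedBall x δ) :=
  uniqueDiffOn_convex (convex_closedBall x δ)
    ⟨x, Metric.ball_subset_interior_closedBall (Metric.mem_ball_self hδ)⟩

open Pointwise in
/-- Iterated derivatives along a segment issuing from the centre of a ball. -/
theorem iteratedDerivWithin_comp_segment {u : E → F} {x v : E} {δ : ℝ} (hδ : 0 < δ) {n : ℕ}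
    (hu : ContDiffOn ℝ n u (Metric.closedBall x δ)) (hv : ‖v‖ ≤ δ) {t : ℝ}
    (ht : t ∈ Set.Icc (0 : ℝ) 1) :
    iteratedDerivWithin n (fun t : ℝ => u (x + t • v)) (Set.Icc 0 1) t
      = iteratedFDerivWithin ℝ n u (Metric.closedBall x δ) (x + t • v) (fun _ => v) := by
  -- The affine path is split into a linear map, to which the chain rule for iterated derivatives
  -- applies, and a translation, absorbed by centring the ball at `0`. Derivatives are first taken
  -- within `L ⁻¹' S`, which contains `[0, 1]`.
  set L : ℝ →L[ℝ] E := ContinuousLinearMap.toSpanSingleton ℝ v with hL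
  have hLt : ∀ t, L t = t • v := fun t => ContinuousLinearMap.toSpanSingleton_apply _ _ _
  set S : Set E := Metric.closedBall 0 δ with hS
  have hxS : x +ᵥ S = Metric.closedBall x δ := by
    ext y
    rw [Set.mem_vadd_set_iff_neg_vadd_mem, hS, mem_closedBall_zero_iff, mem_closedBall_iff_norm,
      vadd_eq_add, neg_add_eq_sub]
  have hu' : ContDiffOn ℝ n (fun z => u (x + z)) S := by
    refine hu.comp (contDiff_const.add contDiff_id).contDiffOn fun z hz => ?_
    simpa [hS] using hz
  have hsub : Set.Icc (0 : ℝ) 1 ⊆ L ⁻¹' S := by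
    intro s hs
    rw [Set.mem_preimage, hLt, hS, mem_closedBall_zero_iff, norm_smul, Real.norm_of_nonneg hs.1]
    exact (mul_le_of_le_one_left (norm_nonneg _) hs.2).trans hv
  have hud : UniqueDiffOn ℝ (L ⁻¹' S) := by
    refine uniqueDiffOn_convex ((convex_closedBall _ _).linear_preimage L.toLinearMap) ⟨0, ?_⟩
    refine mem_interior_iff_mem_nhds.2 (L.continuous.continuousAt.preimage_mem_nhds ?_)
    rw [map_zero]
    exact Metric.closedBall_mem_nhds _ hδ
  have hg : (fun t : ℝ => u (x + t • v)) = (fun z => u (x + z)) ∘ L := by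
    ext t; simp [hLt]
  rw [iteratedDerivWithin_eq_iteratedFDerivWithin, hg,
    iteratedFDerivWithin_subset hsub (uniqueDiffOn_Icc zero_lt_one) hud
      (hu'.comp L.contDiff.contDiffOn fun _ h => h) ht,
    L.iteratedFDerivWithin_comp_right hu' (uniqueDiffOn_closedBall hδ) hud (hsub ht) le_rfl,
    iteratedFDerivWithin_comp_add_left, hxS, hLt]
  simp only [ContinuousMultilinearMap.compContinuousLinearMap_apply, hLt, one_smul]

/-- Taylor's formula with a bound of the remainder on a closed ball. -/
theorem norm_sub_taylor_le {u : E → F} {x y : E} {δ N : ℝ} (hδ : 0 < δ) {m : ℕ} (hm : 0 < m)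
    (hu : ContDiffOn ℝ m u (Metric.closedBall x δ)) (hy : y ∈ Metric.closedBall x δ)
    (hN : ∀ z ∈ Metric.closedBall x δ,
      ‖iteratedFDerivWithin ℝ m u (Metric.closedBall x δ) z‖ ≤ N) :
    ‖u y - ∑ k ∈ Finset.range m, ((k.factorial : ℝ)⁻¹) •
      iteratedFDerivWithin ℝ k u (Metric.closedBall x δ) x (fun _ => y - x)‖
      ≤ N * ‖y - x‖ ^ m := by
  obtain ⟨n, rfl⟩ : ∃ n, m = n + 1 := ⟨m - 1, by omega⟩
  have hv : ‖y - x‖ ≤ δ := by simpa [dist_eq_norm] using hy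
  have hmem : ∀ t ∈ Set.Icc (0 : ℝ) 1, x + t • (y - x) ∈ Metric.closedBall x δ := fun t ht => by
    rw [mem_closedBall_iff_norm, add_sub_cancel_left, norm_smul, Real.norm_of_nonneg ht.1]
    exact (mul_le_of_le_one_left (norm_nonneg _) ht.2).trans hv
  have hg : ContDiffOn ℝ (n + 1) (fun t : ℝ => u (x + t • (y - x))) (Set.Icc 0 1) := by
    have : ContDiff ℝ ((n + 1 : ℕ) : WithTop ℕ∞) fun t : ℝ => x + t • (y - x) := by fun_prop
    exact_mod_cast hu.comp this.contDiffOn hmem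
  have hN0 : 0 ≤ N := (norm_nonneg _).trans (hN x (Metric.mem_closedBall_self hδ.le))
  have hb := taylor_mean_remainder_bound (C := N * ‖y - x‖ ^ (n + 1)) (x := 1) zero_le_one hg
    (Set.right_mem_Icc.2 zero_le_one) (fun t ht => by
      rw [iteratedDerivWithin_comp_segment hδ hu hv ht]
      refine (ContinuousMultilinearMap.le_opNorm _ _).trans ?_
      rw [Finset.prod_const, Finset.card_univ, Fintype.card_fin]
      exact mul_le_mul_of_nonneg_right (hN _ (hmem t ht)) (by positivity))
  rw [taylor_within_apply] at hb
  have hsum : ∀ k ∈ Finset.range (n + 1),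
      (((k.factorial : ℝ)⁻¹) * (1 - 0) ^ k) •
        iteratedDerivWithin k (fun t : ℝ => u (x + t • (y - x))) (Set.Icc 0 1) 0
      = ((k.factorial : ℝ)⁻¹) •
        iteratedFDerivWithin ℝ k u (Metric.closedBall x δ) x (fun _ => y - x) := fun k hk => by
    rw [iteratedDerivWithin_comp_segment hδ
      (hu.of_le (by exact_mod_cast (Finset.mem_range.1 hk).le)) hv
      (Set.left_mem_Icc.2 zero_le_one)]
    simp
  rw [Finset.sum_congr rfl hsum] at hb
  simp only [one_smul, add_sub_cancel, sub_zero, one_pow, mul_one] at hb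
  refine hb.trans (div_le_self (by positivity) ?_)
  exact_mod_cast Nat.one_le_iff_ne_zero.2 (Nat.factorial_ne_zero n)

end Taylor

theorem norm_iteratedFDerivWithin_le_cNorm {d n : ℕ} {S : Set (Pt d)} (hS : IsCompact S)
    (hS' : UniqueDiffOn ℝ S) {u : Pt d → Pt d} (hu : ContDiffOn ℝ n u S) {j : ℕ} (hj : j ≤ n)
    {x : Pt d} (hx : x ∈ S) : ‖iteratedFDerivWithin ℝ j u S x‖ ≤ cNorm n S u := by
  -- A real `⨆` over an unbounded family is `0`; compactness and continuity exclude this.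
  have hbdd : BddAbove (Set.range fun x : S => ‖iteratedFDerivWithin ℝ j u S (x : Pt d)‖) := by
    have := hS.bddAbove_image (f := fun x => ‖iteratedFDerivWithin ℝ j u S x‖)
      (hu.continuousOn_iteratedFDerivWithin (by exact_mod_cast hj) hS').norm
    rwa [Set.image_eq_range] at this
  have h1 := le_ciSup hbdd ⟨x, hx⟩
  refine h1.trans ?_
  exact le_ciSup (f := fun j : Fin (n + 1) =>
    ⨆ x : S, ‖iteratedFDerivWithin ℝ (j : ℕ) u S (x : Pt d)‖) (Set.finite_range _).bddAbove
    ⟨j, Nat.lt_succ_of_le hj⟩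

/-- A multilinear form on the diagonal is a polynomial. -/
theorem exists_mvPolynomial_multilinear {d k : ℕ} (A : ContinuousMultilinearMap ℝ
    (fun _ : Fin k => Pt d) (Pt d)) (x : Pt d) (i : Fin d) :
    ∃ p : MvPolynomial (Fin d) ℝ, p.totalDegree ≤ k ∧
      ∀ y : Pt d, MvPolynomial.eval y.ofLp p = (A fun _ => y - x) i := by
  -- Expansion of `y - x` in the standard basis in each of the `k` slots.
  refine ⟨∑ r : Fin k → Fin d, MvPolynomial.C ((A fun j => EuclideanSpace.single (r j) 1) i) *
    ∏ j, (MvPolynomial.X (r j) - MvPolynomial.C (x (r j))), ?_, fun y => ?_⟩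
  · refine MvPolynomial.totalDegree_finsetSum_le fun r _ => ?_
    refine (MvPolynomial.totalDegree_mul _ _).trans ?_
    rw [MvPolynomial.totalDegree_C, zero_add]
    refine (MvPolynomial.totalDegree_finsetProd _ _).trans ?_
    refine (Finset.sum_le_card_nsmul _ _ 1 fun j _ => ?_).trans (by simp)
    refine (MvPolynomial.totalDegree_sub _ _).trans ?_
    simp
  · have hy : (fun _ : Fin k => y - x)
        = fun _ : Fin k => ∑ l, (y l - x l) • EuclideanSpace.single l (1 : ℝ) := by
      funext _
      ext l
      simp [Finset.sum_apply, Pi.single_apply]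
    rw [hy, A.map_sum]
    simp only [map_sum, map_mul, map_prod, map_sub, MvPolynomial.eval_C, MvPolynomial.eval_X,
      A.map_smul_univ (fun j => _) (fun j => _), WithLp.ofLp_sum, Finset.sum_apply,
      PiLp.smul_apply, smul_eq_mul, mul_comm]

end StaggeredGMLS

/-! ### The comparison polynomial, cones and packing -/

namespace StaggeredGMLS

theorem fderiv_eq_iteratedFDerivWithin_one {d : ℕ} {u : Pt d → Pt d} {x : Pt d} {δ : ℝ}
    (hδ : 0 < δ) (v : Pt d) :
    iteratedFDerivWithin ℝ 1 u (Metric.closedBall x δ) x (fun _ => v) = fderiv ℝ u x v := by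
  rw [iteratedFDerivWithin_one_apply
    (uniqueDiffOn_closedBall hδ x (Metric.mem_closedBall_self hδ.le)),
    fderivWithin_of_mem_nhds (Metric.closedBall_mem_nhds x hδ)]

/-- The Taylor expansion of `u` yields a polynomial in `P_m^x` close to the radial component. -/
theorem exists_polySpace_radialComponent {d m : ℕ} (hm : 0 < m) {u : Pt d → Pt d} {x : Pt d}
    {δ N : ℝ} (hδ : 0 < δ) (hu : ContDiffOn ℝ m u (Metric.closedBall x δ))
    (hN : ∀ z ∈ Metric.closedBall x δ,
      ‖iteratedFDerivWithin ℝ m u (Metric.closedBall x δ) z‖ ≤ N) :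
    ∃ q ∈ polySpace m x,
      (∀ y ∈ Metric.closedBall x δ,
        |radialComponent u x y - MvPolynomial.eval y.ofLp q| ≤ 2 * N * δ ^ (m + 1)) ∧
      (∀ k, MvPolynomial.eval x.ofLp (MvPolynomial.pderiv k q) = 2 * u x k) ∧
      (2 ≤ m → ∀ k, MvPolynomial.eval x.ofLp (MvPolynomial.pderiv k (MvPolynomial.pderiv k q))
        = 4 * (fderiv ℝ u x (EuclideanSpace.single k 1)) k) := by
  set S := Metric.closedBall x δ with hS
  set D : (j : ℕ) → ContinuousMultilinearMap ℝ (fun _ : Fin j => Pt d) (Pt d) :=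
    fun j => iteratedFDerivWithin ℝ j u S x with hD
  choose p hp hpe using fun j => exists_mvPolynomial_multilinear (D j) x
  set q : MvPolynomial (Fin d) ℝ := ∑ j ∈ Finset.range m, ∑ i,
    MvPolynomial.C (2 * (j.factorial : ℝ)⁻¹) *
      (p j i * (MvPolynomial.X i - MvPolynomial.C (x i))) with hq
  have hqe : ∀ y : Pt d, MvPolynomial.eval y.ofLp q = ∑ j ∈ Finset.range m, ∑ i,
      2 * (j.factorial : ℝ)⁻¹ * (D j (fun _ => y - x) i * (y i - x i)) := by
    intro y
    simp only [hq, map_sum, map_mul, map_sub, MvPolynomial.eval_C, MvPolynomial.eval_X, hpe]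
  -- Along `e_k` only the component `i = k` survives, and the order `j` Taylor term contributes
  -- exactly `t^(j+1)`. Thus `∂_k q(x)` sees `j = 0` and `∂_k² q(x)` sees `j = 1`, a term present
  -- only if `m ≥ 2`.
  have hline : ∀ k, linePoly q x ((1 : ℝ) • EuclideanSpace.single k 1)
      = ∑ j ∈ Finset.range m, Polynomial.C (2 * (j.factorial : ℝ)⁻¹ *
        D j (fun _ => EuclideanSpace.single k 1) k) * Polynomial.X ^ (j + 1) := by
    intro k
    refine Polynomial.funext fun t => ?_
    rw [eval_linePoly, hqe, Polynomial.eval_finsetSum]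
    refine Finset.sum_congr rfl fun j _ => ?_
    rw [Finset.sum_eq_single k]
    · simp only [add_sub_cancel_left, one_smul, (D j).map_smul_univ (fun _ => t) (fun _ => _),
        Finset.prod_const, Finset.card_univ, Fintype.card_fin, PiLp.add_apply, PiLp.smul_apply,
        smul_eq_mul, Polynomial.eval_mul, Polynomial.eval_C, Polynomial.eval_pow,
        Polynomial.eval_X]
      simp
      ring
    · intro b _ hb
      simp [hb]
    · simp
  refine ⟨q, ⟨?_, ?_⟩, ?_, ?_, ?_⟩
  · refine MvPolynomial.totalDegree_finsetSum_le fun j hj => ?_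
    refine MvPolynomial.totalDegree_finsetSum_le fun i _ => ?_
    refine (MvPolynomial.totalDegree_mul _ _).trans ?_
    rw [MvPolynomial.totalDegree_C, zero_add]
    refine (MvPolynomial.totalDegree_mul _ _).trans ?_
    have h1 : (MvPolynomial.X i - MvPolynomial.C (x i) :
        MvPolynomial (Fin d) ℝ).totalDegree ≤ 1 :=
      (MvPolynomial.totalDegree_sub _ _).trans (by simp)
    have := Finset.mem_range.1 hj
    have := hp j i
    omega
  · rw [hqe]; simp
  · intro y hy
    have hyx : ‖y - x‖ ≤ δ := by simpa [hS, dist_eq_norm] using hy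
    have hN0 : 0 ≤ N := (norm_nonneg _).trans (hN x (Metric.mem_closedBall_self hδ.le))
    have hT := norm_sub_taylor_le hδ hm hu hy hN
    set T := ∑ k ∈ Finset.range m, ((k.factorial : ℝ)⁻¹) •
      iteratedFDerivWithin ℝ k u (Metric.closedBall x δ) x (fun _ => y - x) with hTdef
    have hqT : MvPolynomial.eval y.ofLp q = inner ℝ T ((2 : ℝ) • (y - x)) := by
      rw [hqe, hTdef, sum_inner]
      refine Finset.sum_congr rfl fun j _ => ?_
      rw [PiLp.inner_apply]
      refine Finset.sum_congr rfl fun i _ => ?_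
      simp [hD]
      ring
    rw [hqT, radialComponent, ← inner_sub_left, ← Real.norm_eq_abs]
    refine (norm_inner_le_norm _ _).trans ?_
    rw [norm_smul, Real.norm_of_nonneg zero_le_two]
    calc _ ≤ (N * δ ^ m) * (2 * δ) := by
          refine mul_le_mul (hT.trans ?_) (by linarith) (by positivity) (by positivity)
          exact mul_le_mul_of_nonneg_left (pow_le_pow_left₀ (norm_nonneg _) hyx m) hN0
      _ = _ := by ring
  · intro k
    have h := coeff_one_linePoly q x 1 k
    rw [hline, Polynomial.finsetSum_coeff, Finset.sum_eq_single 0] at h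
    · rw [one_mul] at h
      rw [← h]
      simp [hD]
    · intro b _ hb
      rw [Polynomial.coeff_C_mul, Polynomial.coeff_X_pow, if_neg (by omega), mul_zero]
    · intro h0; exact absurd (Finset.mem_range.2 hm) h0
  · intro hm2 k
    have h := coeff_two_linePoly q x 1 k
    rw [hline, Polynomial.finsetSum_coeff, Finset.sum_eq_single 1] at h
    · rw [Polynomial.coeff_C_mul, Polynomial.coeff_X_pow, if_pos rfl] at h
      simp only [hD, hS, fderiv_eq_iteratedFDerivWithin_one hδ, Nat.factorial_one,
        Nat.cast_one] at h
      linear_combination (-2) * h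
    · intro b _ hb
      rw [Polynomial.coeff_C_mul, Polynomial.coeff_X_pow, if_neg (by omega), mul_zero]
    · intro h0; exact absurd (Finset.mem_range.2 (by omega)) h0

/-- The second derivatives of affine polynomials vanish. -/
theorem pderiv_pderiv_eval_eq_zero {d : ℕ} {p : MvPolynomial (Fin d) ℝ} (hp : p.totalDegree ≤ 1)
    (x : Pt d) (k : Fin d) :
    MvPolynomial.eval x.ofLp (MvPolynomial.pderiv k (MvPolynomial.pderiv k p)) = 0 := by
  have h := coeff_two_linePoly p x 1 k
  rw [Polynomial.coeff_eq_zero_of_natDegree_lt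
    ((natDegree_linePoly_le hp _ _).trans_lt one_lt_two)] at h
  linarith

/-- A cone of radius `R` contains a ball of radius `R sin θ / (1 + sin θ)`. -/
theorem closedBall_subset_of_cone {d : ℕ} {Ω : Set (Pt d)} {x ξ : Pt d} {r R θ : ℝ}
    (hx : x ∈ Ω) (hθ : 0 < Real.sin θ) (hξ : ‖ξ‖ = 1) (hR : 0 < R)
    (hRr : R ≤ r)
    (hcone : ∀ y : Pt d, ‖y‖ = 1 → Real.cos θ ≤ inner ℝ y ξ →
      ∀ t : ℝ, 0 ≤ t → t ≤ r → x + t • y ∈ Ω) :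
    Metric.closedBall (x + (R / (1 + Real.sin θ)) • ξ) (R * Real.sin θ / (1 + Real.sin θ))
      ⊆ Ω ∩ Metric.closedBall x R := by
  intro w hw
  set s := Real.sin θ
  set a := R / (1 + s) with ha
  have ha0 : 0 < a := by positivity
  have has : a + a * s = R := by rw [ha]; field_simp
  set v := w - x with hv
  have hva : ‖v - a • ξ‖ ≤ a * s := by
    rw [mem_closedBall_iff_norm, ← sub_sub] at hw
    convert hw using 1
    rw [ha]; ring
  have hvR : ‖v‖ ≤ R := by
    calc ‖v‖ = ‖(v - a • ξ) + a • ξ‖ := by rw [sub_add_cancel]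
      _ ≤ a * s + a := (norm_add_le _ _).trans (by
        rw [norm_smul, hξ, Real.norm_of_nonneg ha0.le, mul_one]; linarith)
      _ = R := by linarith
  refine ⟨?_, by rw [mem_closedBall_iff_norm]; exact hvR⟩
  rcases eq_or_ne v 0 with h0 | h0
  · rw [hv, sub_eq_zero] at h0; rwa [h0]
  have hvpos : 0 < ‖v‖ := norm_pos_iff.2 h0
  have hsq : ‖v - a • ξ‖ ^ 2 = ‖v‖ ^ 2 - 2 * a * inner ℝ v ξ + a ^ 2 := by
    rw [norm_sub_sq_real, inner_smul_right, norm_smul, hξ, Real.norm_of_nonneg ha0.le]; ring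
  -- Squaring `‖v - aξ‖ ≤ a sin θ` gives `2a⟪v, ξ⟫ ≥ ‖v‖² + a² cos² θ ≥ 2a cos θ ‖v‖`.
  have hin : Real.cos θ * ‖v‖ ≤ inner ℝ v ξ := by
    have h1 : ‖v - a • ξ‖ ^ 2 ≤ (a * s) ^ 2 := pow_le_pow_left₀ (norm_nonneg _) hva 2
    have h2 : s ^ 2 + Real.cos θ ^ 2 = 1 := Real.sin_sq_add_cos_sq θ
    have h3 : 2 * a * (Real.cos θ * ‖v‖) ≤ 2 * a * inner ℝ v ξ := by
      nlinarith [sq_nonneg (‖v‖ - a * Real.cos θ)]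
    exact le_of_mul_le_mul_left h3 (by positivity)
  have := hcone (‖v‖⁻¹ • v) (by rw [norm_smul, norm_inv, norm_norm, inv_mul_cancel₀ hvpos.ne'])
    (by rw [real_inner_smul_left, le_inv_mul_iff₀ hvpos, mul_comm]; exact hin)
    ‖v‖ hvpos.le (hvR.trans hRr)
  rwa [smul_smul, mul_inv_cancel₀ hvpos.ne', one_smul, hv, add_sub_cancel] at this

/-- Separated points in a ball: their number is bounded in terms of the ratio of the scales. -/
theorem exists_card_le_of_separated (d : ℕ) (K c : ℝ) (hc : 0 < c) :
    ∃ n : ℕ, ∀ (X : Finset (Pt d)) (x : Pt d) (h : ℝ), 0 < h →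
      (∀ y ∈ X, ‖x - y‖ ≤ K * h) →
      (∀ y ∈ X, ∀ z ∈ X, y ≠ z → 2 * h ≤ c * ‖y - z‖) → X.card ≤ n := by
  classical
  -- After rescaling by `h`, two points assigned to the same centre of a `1/c`-net would be closer
  -- than `2h/c`.
  obtain ⟨t, ht, hcov⟩ := Metric.totallyBounded_iff.1
    (isCompact_closedBall (0 : Pt d) K).totallyBounded (1 / c) (by positivity)
  refine ⟨ht.toFinset.card, fun X x h hh hX hsep => ?_⟩
  have hex : ∀ y ∈ X, ∃ a ∈ t, dist (h⁻¹ • (y - x)) a < 1 / c := by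
    intro y hy
    have : h⁻¹ • (y - x) ∈ Metric.closedBall (0 : Pt d) K := by
      rw [mem_closedBall_zero_iff, norm_smul, norm_inv, Real.norm_of_nonneg hh.le,
        inv_mul_le_iff₀ hh, norm_sub_rev, mul_comm]
      exact hX y hy
    simpa using hcov this
  choose! g hgt hg using hex
  refine Finset.card_le_card_of_injOn g (fun y hy => ?_) fun y hy z hz hyz => ?_
  · simpa using hgt y hy
  · by_contra hne
    have h1 := hg y hy
    have h2 := hg z hz
    rw [← hyz] at h2
    have h3 := (dist_triangle_right (h⁻¹ • (y - x)) (h⁻¹ • (z - x)) (g y)).trans_lt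
      (add_lt_add h1 h2)
    rw [dist_eq_norm, ← smul_sub, sub_sub_sub_cancel_right, norm_smul, norm_inv,
      Real.norm_of_nonneg hh.le, inv_mul_lt_iff₀ hh] at h3
    have h4 := hsep y hy z hz hne
    have h5 : c * ‖y - z‖ < c * (h * (1 / c + 1 / c)) := mul_lt_mul_of_pos_left h3 hc
    have h6 : c * (h * (1 / c + 1 / c)) = 2 * h := by field_simp; ring
    linarith

end StaggeredGMLS

/-! ### Weighted least squares, fill and separation distances -/

namespace StaggeredGMLS

section LeastSquares

variable {d m : ℕ} {Φ : ℝ → ℝ} {X : Finset (Pt d)} {x : Pt d} {f : Pt d → ℝ}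
  {p q : MvPolynomial (Fin d) ℝ}

/-- `P_m^x` as a subspace of the polynomial ring. -/
noncomputable def polySubmodule (m : ℕ) (x : Pt d) : Submodule ℝ (MvPolynomial (Fin d) ℝ) :=
  MvPolynomial.restrictTotalDegree (Fin d) ℝ m ⊓
    LinearMap.ker (MvPolynomial.aeval x.ofLp : MvPolynomial (Fin d) ℝ →ₐ[ℝ] ℝ).toLinearMap

theorem mem_polySubmodule : p ∈ polySubmodule m x ↔ p ∈ polySpace m x := by
  simp [polySubmodule, polySpace, MvPolynomial.mem_restrictTotalDegree, MvPolynomial.aeval_eq_eval]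

/-- Weighting values by `√Φ` turns the functional into a squared distance in `ℝ^X` to a
finite-dimensional subspace, where a nearest point exists even without unisolvence. -/
theorem exists_isGMLSFit (hΦ : ∀ y ∈ X, 0 ≤ Φ ‖x - y‖) : ∃ p, IsGMLSFit m Φ X x f p := by
  let T : MvPolynomial (Fin d) ℝ →ₗ[ℝ] EuclideanSpace ℝ X :=
    { toFun := fun p => WithLp.toLp 2 fun y : X =>
        Real.sqrt (Φ ‖x - y‖) * MvPolynomial.eval (y : Pt d).ofLp p
      map_add' := fun p q => by ext y; simp [mul_add]
      map_smul' := fun a p => by ext y; simp [MvPolynomial.smul_eval]; ring }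
  let g : EuclideanSpace ℝ X := WithLp.toLp 2 fun y : X => Real.sqrt (Φ ‖x - y‖) * f y
  have hls : ∀ p, lsFunctional Φ X x f p = ‖g - T p‖ ^ 2 := by
    intro p
    rw [EuclideanSpace.norm_sq_eq, lsFunctional,
      ← Finset.sum_coe_sort X fun y => (f y - MvPolynomial.eval y.ofLp p) ^ 2 * Φ ‖x - y‖]
    refine Finset.sum_congr rfl fun y _ => ?_
    simp only [g, T, LinearMap.coe_mk, AddHom.coe_mk, PiLp.sub_apply, Real.norm_eq_abs, sq_abs]
    rw [← mul_sub, mul_pow, Real.sq_sqrt (hΦ y y.2), mul_comm]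
  set W := (polySubmodule m x).map T
  obtain ⟨w, hw, hmin⟩ := W.exists_norm_eq_iInf_of_complete_subspace
    (Submodule.complete_of_finiteDimensional W) g
  obtain ⟨p, hp, rfl⟩ := hw
  refine ⟨p, mem_polySubmodule.1 hp, fun q hq => ?_⟩
  rw [hls, hls]
  refine pow_le_pow_left₀ (norm_nonneg _) ?_ 2
  rw [hmin]
  exact ciInf_le (f := fun w : (W : Set (EuclideanSpace ℝ X)) => ‖g - w‖)
    ⟨0, Set.forall_mem_range.2 fun _ => norm_nonneg _⟩
    ⟨T q, q, mem_polySubmodule.2 hq, rfl⟩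

/-- From `(a - b)² ≤ 2a² + 2b²` with `a`, `b` the two residuals, and minimality of `p`. -/
theorem IsGMLSFit.sum_sq_sub_le (hΦ : ∀ y ∈ X, 0 ≤ Φ ‖x - y‖) (hp : IsGMLSFit m Φ X x f p)
    (hq : q ∈ polySpace m x) :
    ∑ y ∈ X, (MvPolynomial.eval y.ofLp (p - q)) ^ 2 * Φ ‖x - y‖
      ≤ 4 * lsFunctional Φ X x f q := by
  have h : ∑ y ∈ X, (MvPolynomial.eval y.ofLp (p - q)) ^ 2 * Φ ‖x - y‖
      ≤ 2 * lsFunctional Φ X x f p + 2 * lsFunctional Φ X x f q := by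
    rw [lsFunctional, lsFunctional, Finset.mul_sum, Finset.mul_sum, ← Finset.sum_add_distrib]
    refine Finset.sum_le_sum fun y hy => ?_
    rw [map_sub]
    have h1 := mul_nonneg (sq_nonneg ((f y - MvPolynomial.eval y.ofLp p)
      + (f y - MvPolynomial.eval y.ofLp q))) (hΦ y hy)
    nlinarith
  linarith [hp.2 q hq]

/-- Parallelogram law: the midpoint of two minimizers is admissible and cannot do better than
either. -/
theorem IsGMLSFit.sum_sq_sub_eq_zero (hp : IsGMLSFit m Φ X x f p) (hq : IsGMLSFit m Φ X x f q) :
    ∑ y ∈ X, (MvPolynomial.eval y.ofLp (p - q)) ^ 2 * Φ ‖x - y‖ ≤ 0 := by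
  have hr : (1 / 2 : ℝ) • (p + q) ∈ polySpace m x :=
    mem_polySubmodule.1 (Submodule.smul_mem _ _ (Submodule.add_mem _ (mem_polySubmodule.2 hp.1)
      (mem_polySubmodule.2 hq.1)))
  have h : ∑ y ∈ X, (MvPolynomial.eval y.ofLp (p - q)) ^ 2 * Φ ‖x - y‖
      = 2 * lsFunctional Φ X x f p + 2 * lsFunctional Φ X x f q
        - 4 * lsFunctional Φ X x f ((1 / 2 : ℝ) • (p + q)) := by
    simp only [lsFunctional, Finset.mul_sum, ← Finset.sum_add_distrib, ← Finset.sum_sub_distrib]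
    refine Finset.sum_congr rfl fun y _ => ?_
    rw [map_sub, MvPolynomial.smul_eval, map_add]
    ring
  linarith [hp.2 _ hr, hq.2 _ hr]

theorem isGMLSFit_gmlsFit (h : ∃ p, IsGMLSFit m Φ X x f p) :
    IsGMLSFit m Φ X x f (gmlsFit m Φ X x f) := by
  rw [gmlsFit, dif_pos h]
  exact h.choose_spec

end LeastSquares

theorem two_mul_separationDistance_le {d : ℕ} {X : Finset (Pt d)} {y z : Pt d} (hy : y ∈ X)
    (hz : z ∈ X) (hyz : y ≠ z) : 2 * separationDistance X ≤ ‖y - z‖ := by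
  have : sInf {s : ℝ | ∃ x ∈ X, ∃ y ∈ X, x ≠ y ∧ s = ‖x - y‖} ≤ ‖y - z‖ := by
    refine csInf_le ⟨0, ?_⟩ ⟨y, hy, z, hz, hyz, rfl⟩
    rintro _ ⟨_, _, _, _, _, rfl⟩
    exact norm_nonneg _
  rw [separationDistance]
  linarith

theorem exists_norm_sub_le_fillDistance {d : ℕ} {X : Finset (Pt d)} {Ω : Set (Pt d)}
    (hΩ : IsCompact Ω) (hX : X.Nonempty) {y : Pt d} (hy : y ∈ Ω) :
    ∃ z ∈ X, ‖z - y‖ ≤ fillDistance X Ω := by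
  obtain ⟨z, hz, hd⟩ := X.finite_toSet.isCompact.exists_infDist_eq_dist hX y
  refine ⟨z, hz, ?_⟩
  have hbdd : BddAbove (Set.range fun x : Ω => Metric.infDist (x : Pt d) (X : Set (Pt d))) := by
    have := hΩ.bddAbove_image (f := fun x => Metric.infDist x (X : Set (Pt d)))
      (Metric.continuous_infDist_pt _).continuousOn
    rwa [Set.image_eq_range] at this
  rw [← dist_eq_norm, dist_comm, ← hd]
  exact le_ciSup hbdd ⟨y, hy⟩

theorem separationDistance_nonneg {d : ℕ} (X : Finset (Pt d)) : 0 ≤ separationDistance X := by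
  refine mul_nonneg (by norm_num) (Real.sInf_nonneg ?_)
  rintro _ ⟨_, _, _, _, _, rfl⟩
  exact norm_nonneg _

/-- A finite set is not dense in a region with the interior cone property. -/
theorem fillDistance_pos {d : ℕ} {X : Finset (Pt d)} {Ω : Set (Pt d)} (hΩ : IsCompact Ω)
    (hX : X.Nonempty) {r θ : ℝ} (hr : 0 < r) (hcone : InteriorCone Ω r θ) {x : Pt d}
    (hx : x ∈ Ω) : 0 < fillDistance X Ω := by
  by_contra! hle
  have hsub : Ω ⊆ X := fun y hy => by
    obtain ⟨z, hz, hd⟩ := exists_norm_sub_le_fillDistance hΩ hX hy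
    have : z - y = 0 := norm_le_zero_iff.1 (hd.trans hle)
    rw [sub_eq_zero] at this
    rwa [← this]
  obtain ⟨ξ, hξ, hc⟩ := hcone x hx
  have hfin : Ω.Finite := X.finite_toSet.subset hsub
  have hinj : Function.Injective fun t : ℝ => x + t • ξ := by
    have hξ0 : ξ ≠ 0 := by rintro rfl; simp at hξ
    intro s t hst
    exact smul_left_injective ℝ hξ0 (add_left_cancel hst)
  -- The axis of the cone is a nondegenerate segment in `Ω`, which would be finite.
  refine (Set.Icc_infinite hr).image hinj.injOn (hfin.subset ?_)
  rintro _ ⟨t, ht, rfl⟩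
  exact hc ξ hξ (by rw [real_inner_self_eq_norm_sq, hξ]; simpa using Real.cos_le_one θ) t ht.1 ht.2

end StaggeredGMLS

/-! ### Unisolvence and stability of the fit -/

namespace StaggeredGMLS

/-- The nodes near `x` are norming for the polynomials of degree `≤ m` on a ball in the cone. -/
theorem exists_norming_ball {d m : ℕ} (hm : 0 < m) {θ : ℝ} (hθ : 0 < Real.sin θ)
    {Ω : Set (Pt d)} {r : ℝ} (hΩ : IsCompact Ω) (hcone : InteriorCone Ω r θ) {x : Pt d}
    (hx : x ∈ Ω) {X : Finset (Pt d)} (hX : X.Nonempty) (hpos : 0 < fillDistance X Ω)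
    (hr : fillDistance X Ω ≤ r / coneConst m θ) :
    ∃ z : Pt d, ‖x - z‖ ≤ (Real.sin θ)⁻¹ *
        (coneConst m θ * Real.sin θ / (2 * (1 + Real.sin θ)) * fillDistance X Ω) ∧
      ∀ p : MvPolynomial (Fin d) ℝ, p.totalDegree ≤ m → ∀ B : ℝ,
        (∀ y ∈ X, ‖x - y‖ ≤ coneConst m θ * fillDistance X Ω / 2 →
          |MvPolynomial.eval y.ofLp p| ≤ B) →
        ∀ y ∈ Metric.closedBall z
          (coneConst m θ * Real.sin θ / (2 * (1 + Real.sin θ)) * fillDistance X Ω),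
          |MvPolynomial.eval y.ofLp p| ≤ 2 * B := by
  set h := fillDistance X Ω with hh
  set s := Real.sin θ with hs
  have hs1 : s ≤ 1 := Real.sin_le_one θ
  have hm0 : (0 : ℝ) < m := by exact_mod_cast hm
  have hK0 : 0 < coneConst m θ := by rw [coneConst]; positivity
  -- The right side equals `8(1 + s)m²/(3s)`, at least `16m²/3` because `s ≤ 1`.
  have hκ : 5 * (m : ℝ) ^ 2 ≤ coneConst m θ * s / (2 * (1 + s)) := by
    rw [coneConst, ← hs, le_div_iff₀ (by positivity), div_mul_eq_mul_div,
      le_div_iff₀ (by positivity)]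
    have : (m : ℝ) ^ 2 * (1 + s) * s * (30 * s) ≤ (m : ℝ) ^ 2 * (1 + s) * s * (16 * (1 + s)) :=
      mul_le_mul_of_nonneg_left (by linarith) (by positivity)
    nlinarith
  set K := coneConst m θ with hK
  -- `R = δ/4`, so every node used has weight argument at most `1/4`.
  set R := K * h / 2 with hR
  have hR0 : 0 < R := by positivity
  have hRr : R ≤ r := by
    rw [le_div_iff₀ hK0] at hr
    have : 0 < K * h := by positivity
    rw [hR]; linarith
  obtain ⟨ξ, hξ, hc⟩ := hcone x hx
  have hsub := closedBall_subset_of_cone hx hθ hξ hR0 hRr hc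
  rw [← hs] at hsub
  rw [show R * s / (1 + s) = K * s / (2 * (1 + s)) * h by rw [hR]; field_simp] at hsub
  refine ⟨x + (R / (1 + s)) • ξ, ?_, fun p hp B hB => ?_⟩
  · rw [sub_add_cancel_left, norm_neg, norm_smul, hξ, Real.norm_of_nonneg (by positivity), mul_one]
    refine le_of_eq ?_
    rw [hR]; field_simp
  · refine abs_eval_le_two_mul_of_dense hm hp hpos (mul_le_mul_of_nonneg_right hκ hpos.le)
      (X := (X : Set (Pt d))) (fun y hy => exists_norm_sub_le_fillDistance hΩ hX (hsub hy).1)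
      fun y hyX hy => hB y hyX ?_
    have := (hsub hy).2
    rwa [mem_closedBall_iff_norm, norm_sub_rev] at this

/-- Positivity on the half-open `[0, 1/2)` gives no uniform lower bound; the compact `[0, 1/4]`
does. -/
theorem IsWeightProfile.exists_bounds {φ : ℝ → ℝ} (hφ : IsWeightProfile φ) :
    ∃ b B : ℝ, 0 < b ∧ 0 ≤ B ∧ (∀ s, 0 ≤ s → s ≤ 1 / 4 → b ≤ φ s) ∧
      ∀ s, 0 ≤ s → s ≤ 1 → φ s ≤ B := by
  obtain ⟨s₀, hs₀, hmin⟩ := (isCompact_Icc (a := (0 : ℝ)) (b := 1 / 4)).exists_isMinOn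
    ⟨0, by norm_num⟩ (hφ.continuousOn.mono fun _ h => h.1)
  obtain ⟨s₁, hs₁, hmax⟩ := (isCompact_Icc (a := (0 : ℝ)) (b := 1)).exists_isMaxOn
    ⟨0, by norm_num⟩ (hφ.continuousOn.mono fun _ h => h.1)
  exact ⟨φ s₀, φ s₁, hφ.pos _ hs₀.1 (by linarith [hs₀.2]), hφ.nonneg _ hs₁.1,
    fun s h0 h1 => hmin (Set.mem_Icc.2 ⟨h0, h1⟩), fun s h0 h1 => hmax (Set.mem_Icc.2 ⟨h0, h1⟩)⟩

theorem scaledWeight_nonneg {φ : ℝ → ℝ} (hφ : IsWeightProfile φ) {δ t : ℝ} (hδ : 0 < δ)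
    (ht : 0 ≤ t) : 0 ≤ scaledWeight φ δ t :=
  hφ.nonneg _ (by positivity)

/-- Unisolvence: the weighted least-squares problem has exactly one solution. -/
theorem existsUnique_isGMLSFit {d m : ℕ} (hm : 0 < m) {θ : ℝ} (hθ : 0 < Real.sin θ)
    {φ : ℝ → ℝ} (hφ : IsWeightProfile φ)
    {Ω : Set (Pt d)} {r : ℝ} (hΩ : IsCompact Ω) (hcone : InteriorCone Ω r θ) {x : Pt d}
    (hx : x ∈ Ω) {X : Finset (Pt d)} (hX : X.Nonempty) (hpos : 0 < fillDistance X Ω)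
    (hr : fillDistance X Ω ≤ r / coneConst m θ) (f : Pt d → ℝ) :
    ∃! p, IsGMLSFit m (scaledWeight φ (supportRadius m θ X Ω)) X x f p := by
  have hm0 : (0 : ℝ) < m := by exact_mod_cast hm
  have hK0 : 0 < coneConst m θ := by rw [coneConst]; positivity
  have hδ : 0 < supportRadius m θ X Ω := by rw [supportRadius]; positivity
  have hΦ : ∀ y ∈ X, 0 ≤ scaledWeight φ (supportRadius m θ X Ω) ‖x - y‖ :=
    fun y _ => scaledWeight_nonneg hφ hδ (norm_nonneg _)
  obtain ⟨p, hp⟩ := exists_isGMLSFit (m := m) (f := f) hΦ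
  refine ⟨p, hp, fun q hq => ?_⟩
  obtain ⟨z, -, hz⟩ := exists_norming_ball hm hθ hΩ hcone hx hX hpos hr
  have hsum := (Finset.sum_eq_zero_iff_of_nonneg
    fun y hy => mul_nonneg (sq_nonneg _) (hΦ y hy)).1
    (le_antisymm (hq.sum_sq_sub_eq_zero hp) (Finset.sum_nonneg
      fun y hy => mul_nonneg (sq_nonneg _) (hΦ y hy)))
  have hdeg : (q - p).totalDegree ≤ m :=
    (MvPolynomial.totalDegree_sub _ _).trans (max_le hq.1.1 hp.1.1)
  -- Two minimizers agree at all nodes of positive weight; norming with bound `0` makes their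
  -- difference vanish on a ball.
  have h0 := hz (q - p) hdeg 0 fun y hy hyx => by
    have hw : 0 < scaledWeight φ (supportRadius m θ X Ω) ‖x - y‖ := by
      refine hφ.pos _ (by positivity) ?_
      rw [div_lt_iff₀ hδ, supportRadius]
      have : 0 < coneConst m θ * fillDistance X Ω := by positivity
      linarith
    have := (mul_eq_zero.1 (hsum y hy)).resolve_right hw.ne'
    rw [pow_eq_zero_iff two_ne_zero] at this
    rw [this, abs_zero]
  rw [← sub_eq_zero]
  refine eq_zero_of_eval_closedBall (z := z) (ρ := coneConst m θ * Real.sin θ /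
    (2 * (1 + Real.sin θ)) * fillDistance X Ω) (by positivity) fun y hy => ?_
  simpa using h0 y hy

/-- Stability: the first and second derivatives of the least-squares polynomial differ from those
of any `q ∈ P_m^x` by multiples of the uniform distance between `q` and the data. -/
theorem exists_pderiv_sub_le (d m : ℕ) (hm : 0 < m) (θ : ℝ) (hθ : 0 < Real.sin θ) (c : ℝ)
    (hc : 0 < c) (φ : ℝ → ℝ) (hφ : IsWeightProfile φ) :
    ∃ D : ℝ, 0 ≤ D ∧ ∀ (Ω : Set (Pt d)) (r : ℝ), IsCompact Ω → InteriorCone Ω r θ →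
      ∀ x ∈ Ω, ∀ X : Finset (Pt d), X.Nonempty → 0 < fillDistance X Ω →
      fillDistance X Ω ≤ c * separationDistance X →
      fillDistance X Ω ≤ r / coneConst m θ →
      ∀ (f : Pt d → ℝ) (p q : MvPolynomial (Fin d) ℝ) (E : ℝ),
      IsGMLSFit m (scaledWeight φ (supportRadius m θ X Ω)) X x f p → q ∈ polySpace m x →
      (∀ y ∈ Metric.closedBall x (supportRadius m θ X Ω),
        |f y - MvPolynomial.eval y.ofLp q| ≤ E) →
      ∀ k, fillDistance X Ω * |MvPolynomial.eval x.ofLp (MvPolynomial.pderiv k (p - q))| ≤ D * E ∧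
        fillDistance X Ω ^ 2 * |MvPolynomial.eval x.ofLp
          (MvPolynomial.pderiv k (MvPolynomial.pderiv k (p - q)))| ≤ D * E := by
  have hm0 : (0 : ℝ) < m := by exact_mod_cast hm
  have hK0 : 0 < coneConst m θ := by rw [coneConst]; positivity
  obtain ⟨n, hn⟩ := exists_card_le_of_separated d (2 * coneConst m θ) c hc
  obtain ⟨b, B, hb, hB, hφb, hφB⟩ := hφ.exists_bounds
  obtain ⟨A, hA, hpd⟩ := exists_abs_pderiv_le m (Real.sin θ)⁻¹ (by positivity)
  set κ := coneConst m θ * Real.sin θ / (2 * (1 + Real.sin θ)) with hκ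
  have hκ0 : 0 < κ := by positivity
  -- `G * E` bounds `|p - q|` at nodes near `x`: at most `n` nodes with weight at most `B` enter the
  -- functional at `q`, and `b` is the least weight nearby.
  set G := Real.sqrt (4 * n * B / b) with hG
  refine ⟨A * (2 * G) / κ + A * (2 * G) / κ ^ 2, by positivity, ?_⟩
  intro Ω r hΩ hcone x hx X hX hpos hqu hr f p q E hp hq hE k
  set h := fillDistance X Ω with hh
  set δ := supportRadius m θ X Ω with hδdef
  have hδh : δ = 2 * coneConst m θ * h := rfl
  have hδ : 0 < δ := by rw [hδh]; positivity
  have hΦ : ∀ y ∈ X, 0 ≤ scaledWeight φ δ ‖x - y‖ :=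
    fun y _ => scaledWeight_nonneg hφ hδ (norm_nonneg _)
  have hE0 : 0 ≤ E := (abs_nonneg _).trans (hE x (Metric.mem_closedBall_self hδ.le))
  obtain ⟨z, hxz, hz⟩ := exists_norming_ball hm hθ hΩ hcone hx hX hpos hr
  have hJ : lsFunctional (scaledWeight φ δ) X x f q ≤ n * (E ^ 2 * B) := by
    classical
    have hcard : (X.filter fun y => ‖x - y‖ ≤ δ).card ≤ n := by
      refine hn _ x h hpos (fun y hy => (Finset.mem_filter.1 hy).2) fun y hy w hw hyw => ?_
      have := two_mul_separationDistance_le (Finset.mem_filter.1 hy).1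
        (Finset.mem_filter.1 hw).1 hyw
      have := mul_le_mul_of_nonneg_left this hc.le
      linarith
    rw [lsFunctional, ← Finset.sum_filter_of_ne (p := fun y => ‖x - y‖ ≤ δ)]
    · refine (Finset.sum_le_card_nsmul _ _ (E ^ 2 * B) fun y hy => ?_).trans ?_
      · have hyδ := (Finset.mem_filter.1 hy).2
        refine mul_le_mul ?_ (hφB _ (by positivity) ((div_le_one hδ).2 hyδ))
          (hΦ y (Finset.mem_filter.1 hy).1) (by positivity)
        rw [← sq_abs]
        refine pow_le_pow_left₀ (abs_nonneg _) (hE y ?_) 2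
        rwa [mem_closedBall_iff_norm, norm_sub_rev]
      · rw [nsmul_eq_mul]
        exact mul_le_mul_of_nonneg_right (by exact_mod_cast hcard) (by positivity)
    -- Nodes farther than `δ` carry no weight, so the bound `E` is needed only on the `δ`-ball.
    · intro y _ hne
      by_contra! hlt
      exact hne (by rw [scaledWeight, hφ.support _ ((one_lt_div hδ).2 hlt), mul_zero])
  have hdeg : (p - q).totalDegree ≤ m :=
    (MvPolynomial.totalDegree_sub _ _).trans (max_le hp.1.1 hq.1)
  have hball := hz (p - q) hdeg (G * E) fun y hy hyx => by
    have h1 := (Finset.single_le_sum (f := fun y => (MvPolynomial.eval y.ofLp (p - q)) ^ 2 *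
      scaledWeight φ δ ‖x - y‖) (fun y hy => mul_nonneg (sq_nonneg _) (hΦ y hy)) hy).trans
      (hp.sum_sq_sub_le hΦ hq)
    have h2 : b ≤ scaledWeight φ δ ‖x - y‖ := by
      refine hφb _ (by positivity) ?_
      rw [div_le_iff₀ hδ, hδh]
      linarith
    have h3 : (MvPolynomial.eval y.ofLp (p - q)) ^ 2 ≤ 4 * n * B / b * E ^ 2 := by
      rw [div_mul_eq_mul_div, le_div_iff₀ hb]
      have h4 := mul_le_mul_of_nonneg_left h2 (sq_nonneg (MvPolynomial.eval y.ofLp (p - q)))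
      simp only at h1
      linarith
    refine abs_le_of_sq_le_sq ?_ (by positivity)
    rw [mul_pow, hG, Real.sq_sqrt (by positivity)]
    exact h3
  obtain ⟨h1, h2⟩ := hpd (p - q) x z (κ * h) (2 * (G * E)) hdeg (by positivity) hxz hball k
  have e1 : 0 ≤ A * (2 * G) / κ * E := by positivity
  have e2 : 0 ≤ A * (2 * G) / κ ^ 2 * E := by positivity
  rw [add_mul]
  constructor
  · refine le_trans ?_ (le_add_of_nonneg_right e2)
    rw [div_mul_eq_mul_div, le_div_iff₀ hκ0]
    linarith
  · refine le_trans ?_ (le_add_of_nonneg_left e1)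
    rw [div_mul_eq_mul_div, le_div_iff₀ (by positivity)]
    linarith

theorem norm_le_card_mul {d : ℕ} {v : Pt d} {M : ℝ} (hM : 0 ≤ M) (h : ∀ k, |v k| ≤ M) :
    ‖v‖ ≤ d * M := by
  have hd : (d : ℝ) ≤ (d : ℝ) ^ 2 := by exact_mod_cast Nat.le_self_pow two_ne_zero d
  refine (sq_le_sq₀ (norm_nonneg _) (by positivity)).1 ?_
  rw [EuclideanSpace.norm_sq_eq]
  refine (Finset.sum_le_card_nsmul _ _ (M ^ 2) fun k _ =>
    pow_le_pow_left₀ (norm_nonneg _) (h k) 2).trans ?_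
  rw [Finset.card_univ, Fintype.card_fin, nsmul_eq_mul, mul_pow]
  exact mul_le_mul_of_nonneg_right hd (sq_nonneg M)

end StaggeredGMLS

/-! ### The error estimates -/

theorem corollary3p4 (d m : ℕ) (hm : 0 < m) (θ : ℝ) (hθ : 0 < θ) (hθ' : θ < Real.pi / 2)
    (c : ℝ) (φ : ℝ → ℝ) (hφ : StaggeredGMLS.IsWeightProfile φ) :
    ∃ C : ℝ, 0 < C ∧
      ∀ (Ω : Set (StaggeredGMLS.Pt d)) (r : ℝ), 0 < r → IsCompact Ω →
      StaggeredGMLS.InteriorCone Ω r θ →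
      ∀ (nodes : Finset (StaggeredGMLS.Pt d)) (ε : ℝ), 0 < ε →
      ∀ xi ∈ nodes, xi ∈ Ω →
      ∀ (X : Finset (StaggeredGMLS.Pt d)) (h δ : ℝ) (Φ : ℝ → ℝ)
        (Ωstar : Set (StaggeredGMLS.Pt d)),
      X = StaggeredGMLS.midpoints nodes ε xi →
      h = StaggeredGMLS.fillDistance X Ω →
      δ = StaggeredGMLS.supportRadius m θ X Ω →
      Φ = StaggeredGMLS.scaledWeight φ δ →
      Ωstar = Metric.closedBall xi δ →
      StaggeredGMLS.QuasiUniform X Ω c →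
      h ≤ r / StaggeredGMLS.coneConst m θ →
      ∀ u : StaggeredGMLS.Pt d → StaggeredGMLS.Pt d,
      ContDiffOn ℝ ((m + 1 : ℕ) : WithTop ℕ∞) u Ωstar →
        (∃! p, StaggeredGMLS.IsGMLSFit m Φ X xi (StaggeredGMLS.radialComponent u xi) p) ∧
        ‖u xi - StaggeredGMLS.gmlsField m Φ X xi u‖
          ≤ C * h ^ m * StaggeredGMLS.cNorm (m + 1) Ωstar u ∧
        |StaggeredGMLS.divergence u xi - StaggeredGMLS.gmlsDivergence m Φ X xi u|
          ≤ C * h ^ (m - 1) * StaggeredGMLS.cNorm (m + 1) Ωstar u := by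
  have hs : 0 < Real.sin θ := Real.sin_pos_of_pos_of_lt_pi hθ (by linarith [Real.pi_pos])
  have hm0 : (0 : ℝ) < m := by exact_mod_cast hm
  have hK0 : 0 < StaggeredGMLS.coneConst m θ := by rw [StaggeredGMLS.coneConst]; positivity
  -- For `c ≤ 0` quasi-uniformity contradicts the positivity of the fill distance.
  rcases le_or_gt c 0 with hc | hc
  · refine ⟨1, one_pos, ?_⟩
    rintro Ω r hr hΩ hcone nodes ε - xi - hxi X h δ Φ Ωstar - - - - - hqu
    exfalso
    have h1 := StaggeredGMLS.fillDistance_pos hΩ hqu.1 hr hcone hxi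
    have h2 := mul_nonpos_of_nonpos_of_nonneg hc (StaggeredGMLS.separationDistance_nonneg X)
    linarith [hqu.2.2]
  obtain ⟨D, hD, hstab⟩ := StaggeredGMLS.exists_pderiv_sub_le d m hm θ hs c hc φ hφ
  set L := D * (2 * (2 * StaggeredGMLS.coneConst m θ) ^ (m + 1)) with hL
  have hL0 : 0 ≤ L := by positivity
  -- `d * L` comes from stability with `E = 2Nδ^(m+1)`, the last `d` from the divergence when `m =
  -- 1`, and `1` ensures positivity.
  refine ⟨1 + d * L + d, by positivity, ?_⟩
  rintro Ω r hr hΩ hcone nodes ε - xi - hxi X h δ Φ Ωstar - rfl rfl rfl rfl hqu hhr u hu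
  have hpos := StaggeredGMLS.fillDistance_pos hΩ hqu.1 hr hcone hxi
  have huniq := StaggeredGMLS.existsUnique_isGMLSFit hm hs hφ hΩ hcone hxi hqu.1 hpos hhr
    (StaggeredGMLS.radialComponent u xi)
  refine ⟨huniq, ?_⟩
  set δ := StaggeredGMLS.supportRadius m θ X Ω with hδdef
  set h := StaggeredGMLS.fillDistance X Ω with hh
  have hδh : δ = 2 * StaggeredGMLS.coneConst m θ * h := rfl
  have hδ : 0 < δ := by rw [hδh]; positivity
  set N := StaggeredGMLS.cNorm (m + 1) (Metric.closedBall xi δ) u with hN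
  have hNle : ∀ j ≤ m + 1, ∀ z ∈ Metric.closedBall xi δ,
      ‖iteratedFDerivWithin ℝ j u (Metric.closedBall xi δ) z‖ ≤ N := fun j hj z hz =>
    StaggeredGMLS.norm_iteratedFDerivWithin_le_cNorm (isCompact_closedBall xi δ)
      (StaggeredGMLS.uniqueDiffOn_closedBall hδ) hu hj hz
  have hxi' : xi ∈ Metric.closedBall xi δ := Metric.mem_closedBall_self hδ.le
  have hN0 : 0 ≤ N := (norm_nonneg _).trans (hNle 0 (by omega) xi hxi')
  obtain ⟨q, hq, hqE, hq1, hq2⟩ := StaggeredGMLS.exists_polySpace_radialComponent hm hδ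
    (hu.of_le (by exact_mod_cast Nat.le_succ m)) (hNle m (by omega))
  have hp := StaggeredGMLS.isGMLSFit_gmlsFit huniq.exists
  simp only [StaggeredGMLS.gmlsField, StaggeredGMLS.gmlsDivergence, StaggeredGMLS.gmlsGradient,
    StaggeredGMLS.gmlsLaplacian]
  set p := StaggeredGMLS.gmlsFit m (StaggeredGMLS.scaledWeight φ δ) X xi
    (StaggeredGMLS.radialComponent u xi) with hpdef
  have hst := hstab Ω r hΩ hcone xi hxi X hqu.1 hpos hqu.2.2 hhr _ p q _ hp hq hqE
  have hE : D * (2 * N * δ ^ (m + 1)) = L * N * h ^ (m + 1) := by rw [hδh, hL]; ring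
  have hg : ∀ k, |MvPolynomial.eval xi.ofLp (MvPolynomial.pderiv k (p - q))| ≤ L * h ^ m * N := by
    intro k
    have h1 := (hst k).1
    rw [hE] at h1
    refine le_of_mul_le_mul_left (h1.trans (le_of_eq ?_)) hpos
    ring
  have hl : ∀ k, |MvPolynomial.eval xi.ofLp
      (MvPolynomial.pderiv k (MvPolynomial.pderiv k (p - q)))| ≤ L * h ^ (m - 1) * N := by
    intro k
    have h1 := (hst k).2
    rw [hE] at h1
    refine le_of_mul_le_mul_left (h1.trans (le_of_eq ?_)) (pow_pos hpos 2)
    rw [show m + 1 = (m - 1) + 2 by omega, pow_add]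
    ring
  constructor
  · refine (StaggeredGMLS.norm_le_card_mul (M := L * h ^ m * N) (by positivity) fun k => ?_).trans ?_
    · have h1 := hg k
      rw [map_sub, map_sub, hq1] at h1
      have h2 : (u xi - (1 / 2 : ℝ) • WithLp.toLp 2 fun k =>
          MvPolynomial.eval xi.ofLp (MvPolynomial.pderiv k p)) k
          = -(1 / 2) * (MvPolynomial.eval xi.ofLp (MvPolynomial.pderiv k p) - 2 * u xi k) := by
        simp only [PiLp.sub_apply, PiLp.smul_apply, smul_eq_mul]
        ring
      rw [h2, abs_mul, abs_neg, abs_of_pos (by norm_num : (0 : ℝ) < 1 / 2)]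
      linarith [abs_nonneg (MvPolynomial.eval xi.ofLp (MvPolynomial.pderiv k p) - 2 * u xi k)]
    · have : 0 ≤ (1 + d : ℝ) * (h ^ m * N) := by positivity
      linarith
  · rw [StaggeredGMLS.divergence, Finset.mul_sum, ← Finset.sum_sub_distrib]
    refine (Finset.abs_sum_le_sum_abs _ _).trans ?_
    have hterm : ∀ k ∈ Finset.univ, |(fderiv ℝ u xi (EuclideanSpace.single k 1)).ofLp k
        - 1 / 4 * MvPolynomial.eval xi.ofLp (MvPolynomial.pderiv k (MvPolynomial.pderiv k p))|
        ≤ (L + 1) * (h ^ (m - 1) * N) := by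
      intro k _
      -- For `m = 1` the Laplacian of `p*` is zero and the claim is only of order `h^0`: each `|∂_k
      -- u_k(x)|` is bounded by the norm of the first derivative.
      rcases (show m = 1 ∨ 2 ≤ m by omega) with h1 | h2
      · rw [StaggeredGMLS.pderiv_pderiv_eval_eq_zero (hp.1.1.trans h1.le) xi k, mul_zero, sub_zero,
          h1, Nat.sub_self, pow_zero, one_mul]
        have h3 := (hNle 1 (by omega) xi hxi')
        rw [← StaggeredGMLS.fderiv_eq_iteratedFDerivWithin_one hδ]
        rw [← Real.norm_eq_abs]
        refine (PiLp.norm_apply_le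
          (iteratedFDerivWithin ℝ 1 u (Metric.closedBall xi δ) xi fun _ => _) k).trans ?_
        refine (ContinuousMultilinearMap.le_opNorm _ _).trans ?_
        simp only [Finset.prod_const, PiLp.norm_single, norm_one, one_pow, mul_one]
        have : 0 ≤ L * N := by positivity
        linarith
      · have h1 := hl k
        rw [map_sub, map_sub, map_sub, hq2 h2] at h1
        rw [← abs_neg]
        have h3 : -((fderiv ℝ u xi (EuclideanSpace.single k 1)).ofLp k
          - 1 / 4 * MvPolynomial.eval xi.ofLp (MvPolynomial.pderiv k (MvPolynomial.pderiv k p)))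
          = 1 / 4 * (MvPolynomial.eval xi.ofLp (MvPolynomial.pderiv k (MvPolynomial.pderiv k p))
            - 4 * (fderiv ℝ u xi (EuclideanSpace.single k 1)).ofLp k) := by ring
        rw [h3, abs_mul, abs_of_pos (by norm_num : (0 : ℝ) < 1 / 4)]
        have : 0 ≤ h ^ (m - 1) * N := by positivity
        linarith [abs_nonneg (MvPolynomial.eval xi.ofLp
          (MvPolynomial.pderiv k (MvPolynomial.pderiv k p))
            - 4 * (fderiv ℝ u xi (EuclideanSpace.single k 1)).ofLp k)]
    refine (Finset.sum_le_card_nsmul _ _ _ hterm).trans ?_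
    rw [Finset.card_univ, Fintype.card_fin, nsmul_eq_mul]
    have : 0 ≤ h ^ (m - 1) * N := by positivity
    linarith
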